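/- Let $K$ be a field, let $S=K[X_1,\dots,X_m,Y_1,\dots,Y_n]$ be a polynomial ring ($m,n\ge 0$), let $I\subseteq S$ be any monomial ideal (not necessarily squarefree), and let $R=S/I$, with residue classes $x_1,\dots,x_m,y_1,\dots,y_n$ of the variables. Let $P=(y_1,\dots,y_n)\subseteq R$; up to renumbering the variables, every monomial prime ideal of $R$ is of this form. Grade $R$ by $\deg x_i=0$ and $\deg y_k=1$, and let $R_0$ be its component of degree $0$. For $i\ge 0$ the local cohomology module $H^i_P(R)$ is the $i$-th cohomology of the \v{C}ech complex $C^\bullet$ with $$C^t=\bigoplus_{1\le k_1<\dots<k_t\le n}R_{y_{k_1}\cdots y_{k_t}},$$ and it is graded, its component $H^i_P(R)_j$ $(j\in\mathbb Z)$ being the cohomology in degree $j$ of this complex, where $r/y^l\in R_y$ (with $y=y_{k_1}\cdots y_{k_t}$ and $r$ homogeneous) has degree $\deg r-l\deg y$. Thus $H^i_P(R)_j$ is an $R_0$-module. Then for every $i\ge 0$ there is an integer $j_0$ such that the Krull dimension $\dim_{R_0}H^i_P(R)_j$ is the same for all $j\le j_0$ (where the zero module has dimension $-\infty$). -/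

import Mathlib

/-- An ideal of a polynomial ring is a monomial ideal if it is generated by monomials. -/
def IsMonomialIdeal {K σ : Type*} [CommSemiring K] (I : Ideal (MvPolynomial σ K)) : Prop :=
  ∃ T : Set (σ →₀ ℕ), I = Ideal.span ((fun e => MvPolynomial.monomial e (1 : K)) '' T)

namespace Cech

section Complex

variable {R : Type*} [CommRing R] {n : ℕ} (y : Fin n → R)

/-- The product of the elements `y j`, for `j ∈ F`. -/
def prodOn (F : Finset (Fin n)) : R := ∏ j ∈ F, y j

/-- The natural `R`-linear map `R_{y_F} → R_{y_G}` for `F ⊆ G`. -/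
noncomputable def res {F G : Finset (Fin n)} (h : F ⊆ G) :
    Localization.Away (prodOn y F) →ₗ[R] Localization.Away (prodOn y G) :=
  (IsLocalization.liftAlgHom (M := Submonoid.powers (prodOn y F))
    (f := Algebra.ofId R (Localization.Away (prodOn y G))) (by
      rintro ⟨_, l, rfl⟩
      have h1 : IsUnit (algebraMap R (Localization.Away (prodOn y G)) (prodOn y F)) :=
        isUnit_of_dvd_unit (map_dvd _ (Finset.prod_dvd_prod_of_subset F G y h))
          (IsLocalization.Away.algebraMap_isUnit (prodOn y G))
      simpa [Algebra.ofId_apply] using h1.pow l)).toLinearMap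

/-- The term `C^t`: the direct sum of the `R_{y_F}` over the `t`-element subsets `F` of
`{1, …, n}`. -/
abbrev Cochain (t : ℕ) : Type _ :=
  ∀ F : {F : Finset (Fin n) // F.card = t}, Localization.Away (prodOn y F.1)

/-- The differential `C^t → C^{t+1}`: its component from `F = G \ {g}` to `G` is the natural map
times `(-1)^(s-1)`, where `g` is the `s`-th element of `G` in increasing order. -/
noncomputable def d (t : ℕ) : Cochain y t →ₗ[R] Cochain y (t + 1) :=
  LinearMap.pi fun G => ∑ g : {g // g ∈ G.1},
    (-1 : ℤ) ^ (G.1.filter (· < g.1)).card •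
      (res y (G.1.erase_subset g.1) ∘ₗ
        LinearMap.proj (⟨G.1.erase g.1, by
          rw [Finset.card_erase_of_mem g.2, G.2, Nat.add_sub_cancel]⟩ :
            {F : Finset (Fin n) // F.card = t}))

theorem res_res {F G H : Finset (Fin n)} (h : F ⊆ G) (h' : G ⊆ H) (z) :
    res y h' (res y h z) = res y (h.trans h') z := by
  have : (res y h') ∘ₗ (res y h) = res y (h.trans h') := by
    apply IsLocalizedModule.ext (Submonoid.powers (prodOn y F)) (Algebra.linearMap R _)
    · rintro ⟨_, l, rfl⟩
      have h1 : IsUnit (algebraMap R (Localization.Away (prodOn y H)) (prodOn y F)) :=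
        isUnit_of_dvd_unit (map_dvd _ (Finset.prod_dvd_prod_of_subset F H y (h.trans h')))
          (IsLocalization.Away.algebraMap_isUnit (prodOn y H))
      rw [Module.End.isUnit_iff]
      have h2 := h1.pow l
      rw [← map_pow] at h2
      convert (IsUnit.isUnit_iff_mulLeft_bijective).1 h2 using 1
      ext x
      rw [Module.algebraMap_end_apply, Algebra.smul_def]
    · ext; simp [res]
  exact LinearMap.congr_fun this z

/-- The Čech complex is a complex. -/
theorem d_d (t : ℕ) (z : Cochain y t) : d y (t + 1) (d y t z) = 0 := by
  funext H
  have key : ∀ F (h1 : F.card = t) (h2 : F ⊆ H.1) F' (h1' : F'.card = t) (h2' : F' ⊆ H.1),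
    F = F' → res y h2 (z ⟨F, h1⟩) = res y h2' (z ⟨F', h1'⟩) := by
    rintro F _ _ F' _ _ rfl; rfl
  simp only [d, LinearMap.pi_apply, LinearMap.sum_apply, LinearMap.smul_apply, LinearMap.comp_apply,
    LinearMap.proj_apply, map_sum, map_zsmul, res_res, Finset.smul_sum, Pi.zero_apply, smul_smul]
  rw [Finset.sum_sigma']
  refine Finset.sum_involution (fun p _ => ⟨⟨p.2.1, Finset.mem_of_mem_erase p.2.2⟩,
    ⟨p.1.1, Finset.mem_erase.2 ⟨(Finset.ne_of_mem_erase p.2.2).symm, p.1.2⟩⟩⟩) ?_ ?_ ?_ ?_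
  · rintro ⟨⟨g, hg⟩, ⟨g', hg'⟩⟩ _
    obtain ⟨hne, hg'⟩ := Finset.mem_erase.1 hg'
    dsimp only
    rw [key _ _ _ ((H.1.erase g').erase g) (by
      rw [Finset.card_erase_of_mem, Finset.card_erase_of_mem, H.2]; rfl; exact hg'
      exact Finset.mem_erase.2 ⟨hne.symm, hg⟩) ((Finset.erase_subset _ _).trans (Finset.erase_subset _ _)) (Finset.erase_right_comm), ← add_smul]
    convert zero_smul ℤ _
    wlog hlt : g < g' generalizing g g'
    · rw [add_comm]; exact this g' hg' g (Finset.mem_erase.2 ⟨hne.symm, hg⟩) (by simp) hne.symm hg (lt_of_le_of_ne (not_lt.1 hlt) hne)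
    have e1 : (((H.1.erase g).filter (· < g')).card) + 1 = ((H.1.filter (· < g')).card) := by
      rw [Finset.filter_erase, Finset.card_erase_add_one]
      simp [hg, hlt]
    have e2 : (((H.1.erase g').filter (· < g)).card) = ((H.1.filter (· < g)).card) := by
      rw [Finset.filter_erase, Finset.erase_eq_of_notMem]
      simp [hlt.le]
    rw [e2, ← e1]; ring
  · rintro ⟨⟨g, hg⟩, ⟨g', hg'⟩⟩ _ _ h
    have := Finset.ne_of_mem_erase hg'
    simp at h
    exact this h.1
  · intros; simp
  · rintro ⟨⟨g, hg⟩, ⟨g', hg'⟩⟩ _; rfl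

/-- The cocycles in `C^t`. -/
noncomputable abbrev cocycles (t : ℕ) : Submodule R (Cochain y t) := LinearMap.ker (d y t)

/-- The coboundaries in `C^t`. -/
noncomputable def coboundaries : (t : ℕ) → Submodule R (Cochain y t)
  | 0 => ⊥
  | t + 1 => LinearMap.range (d y t)

/-- The cohomology `H^t` of the Čech complex of `R` with respect to `y`. For `R` Noetherian this
is the local cohomology module of `R` with support in the ideal generated by `y`. -/
abbrev Cohomology (t : ℕ) : Type _ :=
  cocycles y t ⧸ (coboundaries y t).submoduleOf (cocycles y t)

end Complex

section Graded

variable {K R : Type*} [CommRing K] [CommRing R] [Algebra K R]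
  (𝒜 : ℤ → Submodule K R) [SetLike.GradedMonoid 𝒜] {n : ℕ} (y : Fin n → R)

theorem prodOn_mem (hy : ∀ k, y k ∈ 𝒜 1) (F : Finset (Fin n)) :
    prodOn y F ∈ 𝒜 F.card := by
  have := SetLike.prod_mem_graded 𝒜 (fun _ : Fin n => (1 : ℤ)) y (F := F) (fun k _ => hy k)
  simpa [prodOn] using this

/-- The component of degree `j` of `R_{y_F}`, where the `y k` have degree `1`: the fractions
`r / (y_F)^l` with `r` homogeneous of degree `j + l * deg y_F`. -/
noncomputable def awayPiece (hy : ∀ k, y k ∈ 𝒜 1) (F : Finset (Fin n)) (j : ℤ) :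
    Submodule (SetLike.GradeZero.subalgebra 𝒜) (Localization.Away (prodOn y F)) where
  carrier := {z | ∃ (l : ℕ) (r : R), r ∈ 𝒜 (j + l * F.card) ∧
    z = Localization.mk r (⟨prodOn y F ^ l, l, rfl⟩ : Submonoid.powers (prodOn y F))}
  zero_mem' := ⟨0, 0, zero_mem _, (Localization.mk_zero _).symm⟩
  add_mem' := by
    rintro _ _ ⟨l, r, hr, rfl⟩ ⟨l', r', hr', rfl⟩
    refine ⟨l + l', prodOn y F ^ l * r' + prodOn y F ^ l' * r, ?_, ?_⟩
    · have h := fun l : ℕ => SetLike.pow_mem_graded l (prodOn_mem 𝒜 y hy F)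
      refine add_mem ?_ ?_
      · convert SetLike.mul_mem_graded (h l) hr' using 2
        push_cast [nsmul_eq_mul]; ring
      · convert SetLike.mul_mem_graded (h l') hr using 2
        push_cast [nsmul_eq_mul]; ring
    · rw [Localization.add_mk]
      congr 1
      exact Subtype.ext (pow_add _ _ _).symm
  smul_mem' := by
    rintro ⟨c, hc⟩ _ ⟨l, r, hr, rfl⟩
    refine ⟨l, c * r, ?_, ?_⟩
    · have := SetLike.mul_mem_graded (show c ∈ 𝒜 0 from hc) hr
      rwa [zero_add] at this
    · exact Localization.smul_mk c r _

/-- The component of degree `j` of the Čech cohomology `H^t`, as an `R_0`-submodule of `H^t`: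
the classes of the cocycles that are homogeneous of degree `j`. -/
noncomputable def cohomologyPiece (hy : ∀ k, y k ∈ 𝒜 1) (t : ℕ) (j : ℤ) :
    Submodule (SetLike.GradeZero.subalgebra 𝒜) (Cohomology y t) where
  carrier := {c | ∃ z : cocycles y t, (∀ F, z.1 F ∈ awayPiece 𝒜 y hy F.1 j) ∧
    Submodule.Quotient.mk z = c}
  zero_mem' := ⟨0, fun _ => zero_mem _, rfl⟩
  add_mem' := by
    rintro _ _ ⟨z, hz, rfl⟩ ⟨z', hz', rfl⟩
    exact ⟨z + z', fun F => add_mem (hz F) (hz' F), rfl⟩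
  smul_mem' := by
    rintro c _ ⟨z, hz, rfl⟩
    exact ⟨(c : R) • z, fun F => Submodule.smul_mem _ c (hz F), rfl⟩

end Graded

end Cech

namespace MonomialQuotient

open MvPolynomial

variable {K : Type*} [Field K] {m n : ℕ} (I : Ideal (MvPolynomial (Fin m ⊕ Fin n) K))

/-- The component of degree `j` of `R = K[X_1, …, X_m, Y_1, …, Y_n] / I`, for the grading with
`deg x_i = 0` and `deg y_k = 1`. -/
noncomputable def piece (j : ℤ) : Submodule K (MvPolynomial (Fin m ⊕ Fin n) K ⧸ I) :=
  (weightedHomogeneousSubmodule K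
    (Sum.elim (fun _ => 0) (fun _ => 1) : Fin m ⊕ Fin n → ℤ) j).map
      (Ideal.Quotient.mkₐ K I).toLinearMap

instance : SetLike.GradedMonoid (piece I) where
  one_mem := ⟨1, isWeightedHomogeneous_one K _, map_one (Ideal.Quotient.mkₐ K I)⟩
  mul_mem := by
    rintro a b _ _ ⟨p, hp, rfl⟩ ⟨q, hq, rfl⟩
    exact ⟨p * q, IsWeightedHomogeneous.mul hp hq, map_mul (Ideal.Quotient.mkₐ K I) p q⟩

/-- The subring `R_0` of `R`, the component of degree `0`. -/
noncomputable abbrev R₀ : Subalgebra K (MvPolynomial (Fin m ⊕ Fin n) K ⧸ I) :=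
  SetLike.GradeZero.subalgebra (piece I)

/-- The residue class `y_k` of the variable `Y_k`. -/
noncomputable def y (k : Fin n) : MvPolynomial (Fin m ⊕ Fin n) K ⧸ I :=
  Ideal.Quotient.mk I (X (Sum.inr k))

theorem y_mem (k : Fin n) : y I k ∈ piece I 1 :=
  ⟨X (Sum.inr k), isWeightedHomogeneous_X K _ (Sum.inr k), rfl⟩

/-- The local cohomology `H^i_P(R)` of `R` with respect to `P = (y_1, …, y_n)`, computed by the
Čech complex. -/
abbrev LocalCohomology (i : ℕ) : Type _ := Cech.Cohomology (y I) i

/-- The component `H^i_P(R)_j` of `H^i_P(R)`, an `R_0`-module. -/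
noncomputable def localCohomologyPiece (i : ℕ) (j : ℤ) : Submodule (R₀ I) (LocalCohomology I i) :=
  Cech.cohomologyPiece (piece I) (y I) (y_mem I) i j

noncomputable instance (i : ℕ) (j : ℤ) : Module (R₀ I) (localCohomologyPiece I i j) :=
  Submodule.module _

end MonomialQuotient

/-!
The supports of the pieces `H^i_P(R)_j` over `R_0` are one and the same set for all `j < -n`, so
their dimensions agree.

Since `I` is a monomial ideal, the Čech complex is graded by `ℤ^n`, and the multigraded components
of a cocycle that is homogeneous of degree `j` are cocycles of multidegrees `b` with `∑ k, b k = j`.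
A prime `p` of `R_0` lies in the support of a module if and only if some element is annihilated by
no `r ∉ p`; hence a point of the support of `H^i_P(R)_j` is already detected by a class of a single
multidegree `b` (`exists_component_of_mem_support`).

The component of `R_{y_F}` of multidegree `b` vanishes if `b k < 0` for some `k ∉ F`, because the
`k`-th coordinate can be made negative only by inverting `y_k` (`component_eq_zero_of_neg`). So for
`b k < 0` a cochain of multidegree `b` lives on the sets `F` that contain `k`. The cochains of this
kind form a subcomplex on which multiplication by `y_k` is bijective (`Cech.supportedOn`). It
follows that multiplication by `y_k` maps the cohomology in multidegree `b` isomorphically onto that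
in multidegree `b + e_k` if `b k ≤ -2`. It is also `R_0`-linear, so it preserves supports. If
`j < -n`, then some coordinate of `b` is at most `-2`, and if `j + 1 < 0`, then a multidegree of
total degree `j + 1` has a negative coordinate; this gives the two inclusions between the supports
in the degrees `j` and `j + 1`.

The multigrading of `R_{y_F}` is encoded by a coaction, a ring homomorphism `R_{y_F} → R_{y_F}[ℤ^n]`
that sends `z`, homogeneous of degree `b`, to `z T^b`. The universal properties of quotients and
localizations then provide well-defined projections to the components.
-/

theorem Submodule.prod_smul_sum_mem {R M ι : Type*} [CommRing R] [AddCommGroup M] [Module R M]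
    (N : Submodule R M) (s : Finset ι) {r : ι → R} {f : ι → M} (h : ∀ b ∈ s, r b • f b ∈ N) :
    (∏ b ∈ s, r b) • ∑ b ∈ s, f b ∈ N := by
  classical
  rw [Finset.smul_sum]
  refine N.sum_mem fun b hb => ?_
  rw [← Finset.prod_erase_mul s r hb, mul_smul]
  exact N.smul_mem _ (h b hb)

/-! ### Dividing Čech cochains by one of the elements -/

namespace Cech

section Divide

variable {R : Type*} [CommRing R] {n : ℕ} (y : Fin n → R)

theorem d_apply (t : ℕ) (z : Cochain y t) (G : {G : Finset (Fin n) // G.card = t + 1}) :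
    d y t z G = ∑ g : {g // g ∈ G.1}, (-1 : ℤ) ^ (G.1.filter (· < g.1)).card •
      res y (G.1.erase_subset g.1) (z ⟨G.1.erase g.1, by
        rw [Finset.card_erase_of_mem g.2, G.2, Nat.add_sub_cancel]⟩) := by
  simp [d]

theorem d_smul (t : ℕ) (r : R) (z : Cochain y t) : d y t (r • z) = r • d y t z :=
  map_smul _ r z

theorem smul_away_eq (F : Finset (Fin n)) (r : R) (z : Localization.Away (prodOn y F)) :
    r • z = algebraMap R (Localization.Away (prodOn y F)) r * z :=
  Algebra.smul_def r z

theorem isUnit_algebraMap_away {F : Finset (Fin n)} {k : Fin n} (hk : k ∈ F) :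
    IsUnit (algebraMap R (Localization.Away (prodOn y F)) (y k)) :=
  isUnit_of_dvd_unit (map_dvd _ (Finset.dvd_prod_of_mem y hk))
    (IsLocalization.Away.algebraMap_isUnit (prodOn y F))

theorem smul_away_injective {F : Finset (Fin n)} {k : Fin n} (hk : k ∈ F) :
    Function.Injective fun z : Localization.Away (prodOn y F) => y k • z := by
  intro a b h
  simp only [Algebra.smul_def] at h
  exact (isUnit_algebraMap_away y hk).mul_left_cancel h

/-- The cochains whose components in `R_{y_F}` vanish for all `F` that do not contain `k`.
They form a subcomplex of the Čech complex, on which `y k` acts bijectively. -/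
def supportedOn (k : Fin n) (t : ℕ) : Submodule R (Cochain y t) where
  carrier := {z | ∀ F, k ∉ F.1 → z F = 0}
  zero_mem' := fun _ _ => rfl
  add_mem' := fun {a b} ha hb F hF => by
    rw [Pi.add_apply, ha F hF, hb F hF, add_zero]
  smul_mem' := fun c z hz F hF => by
    rw [Pi.smul_apply, hz F hF, smul_zero]

theorem d_mem_supportedOn {k : Fin n} {t : ℕ} {z : Cochain y t} (hz : z ∈ supportedOn y k t) :
    d y t z ∈ supportedOn y k (t + 1) := by
  intro G hG
  rw [d_apply]
  refine Finset.sum_eq_zero fun g _ => ?_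
  rw [hz _ fun h => hG (Finset.mem_of_mem_erase h), map_zero, zsmul_zero]

theorem smul_injOn_supportedOn {k : Fin n} {t : ℕ} {z z' : Cochain y t}
    (hz : z ∈ supportedOn y k t) (hz' : z' ∈ supportedOn y k t) (h : y k • z = y k • z') :
    z = z' := by
  funext F
  by_cases hF : k ∈ F.1
  · exact smul_away_injective y hF (congrFun h F)
  · rw [hz F hF, hz' F hF]

theorem exists_smul_eq_of_mem_supportedOn {k : Fin n} {t : ℕ} {z : Cochain y t}
    (hz : z ∈ supportedOn y k t) : ∃ u ∈ supportedOn y k t, y k • u = z := by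
  have h : ∀ F : {F : Finset (Fin n) // F.card = t},
      ∃ u : Localization.Away (prodOn y F.1), (k ∉ F.1 → u = 0) ∧ y k • u = z F := by
    intro F
    by_cases hF : k ∈ F.1
    · obtain ⟨u, hu⟩ := (isUnit_algebraMap_away y hF).dvd (a := z F)
      exact ⟨u, fun h => absurd hF h, by rw [Algebra.smul_def, ← hu]⟩
    · exact ⟨0, fun _ => rfl, by rw [smul_zero, hz F hF]⟩
  choose u hu hu' using h
  exact ⟨u, hu, funext hu'⟩

theorem d_eq_zero_of_smul {k : Fin n} {t : ℕ} {u : Cochain y t} (hu : u ∈ supportedOn y k t)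
    (h : d y t (y k • u) = 0) : d y t u = 0 :=
  smul_injOn_supportedOn y (d_mem_supportedOn y hu) (zero_mem _) (by rw [← d_smul, h, smul_zero])

theorem mem_range_d_of_smul {k : Fin n} {t : ℕ} {v : Cochain y (t + 1)} {w : Cochain y t}
    (hv : v ∈ supportedOn y k (t + 1)) (hw : w ∈ supportedOn y k t) (h : d y t w = y k • v) :
    v ∈ LinearMap.range (d y t) := by
  obtain ⟨u, hu, rfl⟩ := exists_smul_eq_of_mem_supportedOn y hw
  refine ⟨u, smul_injOn_supportedOn y (d_mem_supportedOn y hu) hv ?_⟩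
  rw [← d_smul, h]

end Divide

section GradedDivide

variable {K R : Type*} [CommRing K] [CommRing R] [Algebra K R]
  (𝒜 : ℤ → Submodule K R) [SetLike.GradedMonoid 𝒜] {n : ℕ} (y : Fin n → R)

theorem smul_mem_awayPiece (hy : ∀ k, y k ∈ 𝒜 1) {F : Finset (Fin n)} {j : ℤ} (k : Fin n)
    {z : Localization.Away (prodOn y F)} (hz : z ∈ awayPiece 𝒜 y hy F j) :
    y k • z ∈ awayPiece 𝒜 y hy F (j + 1) := by
  obtain ⟨l, r, hr, rfl⟩ := hz
  refine ⟨l, y k * r, ?_, Localization.smul_mk _ _ _⟩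
  convert SetLike.mul_mem_graded (hy k) hr using 2
  ring

theorem mem_awayPiece_of_smul_mem (hy : ∀ k, y k ∈ 𝒜 1) {F : Finset (Fin n)} {j : ℤ} {k : Fin n}
    (hk : k ∈ F) {u : Localization.Away (prodOn y F)}
    (hu : y k • u ∈ awayPiece 𝒜 y hy F (j + 1)) : u ∈ awayPiece 𝒜 y hy F j := by
  obtain ⟨l, r, hr, h⟩ := hu
  -- `u = r / (y_k * y_F ^ l) = (r * y_{F \ {k}}) / y_F ^ (l + 1)`
  refine ⟨l + 1, r * prodOn y (F.erase k), ?_, smul_away_injective y hk ?_⟩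
  · convert SetLike.mul_mem_graded hr (prodOn_mem 𝒜 y hy (F.erase k)) using 2
    have := Finset.card_erase_add_one hk
    push_cast [← this]
    ring
  · dsimp only
    rw [h, Localization.smul_mk, Localization.mk_eq_mk_iff, Localization.r_iff_exists]
    refine ⟨1, ?_⟩
    have := Finset.mul_prod_erase F y hk
    simp only [OneMemClass.coe_one, one_mul, smul_eq_mul, prodOn] at this ⊢
    rw [pow_succ, ← this]
    ring

end GradedDivide

end Cech

/-! ### The multigrading on the localizations -/

namespace MonomialQuotient

open MvPolynomial

variable {K : Type*} [Field K] {m n : ℕ} (I : Ideal (MvPolynomial (Fin m ⊕ Fin n) K))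

/-- The exponents of `Y_1, …, Y_n` in the monomial with exponent vector `e`. -/
def yExponent (e : Fin m ⊕ Fin n →₀ ℕ) : Fin n → ℤ := fun k => e (Sum.inr k)

/-- The multidegree of `y_F`. -/
def indicator (F : Finset (Fin n)) : Fin n → ℤ := fun k => if k ∈ F then 1 else 0

/-- The localization `R_{y_F}` of `R`. -/
abbrev Away (F : Finset (Fin n)) : Type _ := Localization.Away (Cech.prodOn (y I) F)

/-- The fraction in `R_{y_F}` with denominator `y_F ^ l` whose numerator is the residue class of the
monomial with exponent vector `e` and coefficient `c`. -/
noncomputable def frac (F : Finset (Fin n)) (l : ℕ) (e : Fin m ⊕ Fin n →₀ ℕ) (c : K) : Away I F :=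
  Localization.mk (Ideal.Quotient.mk I (monomial e c))
    (⟨Cech.prodOn (y I) F ^ l, l, rfl⟩ : Submonoid.powers (Cech.prodOn (y I) F))

theorem mk_sum_eq_sum_frac (F : Finset (Fin n)) (l : ℕ) (p : MvPolynomial (Fin m ⊕ Fin n) K) :
    Localization.mk (Ideal.Quotient.mk I p)
      (⟨Cech.prodOn (y I) F ^ l, l, rfl⟩ : Submonoid.powers (Cech.prodOn (y I) F)) =
    ∑ e ∈ p.support, frac I F l e (coeff e p) := by
  conv_lhs => rw [p.as_sum, map_sum, Localization.mk_sum]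
  rfl

/-- The fractions with monomial numerators generate `R_{y_F}` additively. -/
theorem away_induction {F : Finset (Fin n)} {P : Away I F → Prop} (h0 : P 0)
    (hadd : ∀ a b, P a → P b → P (a + b)) (hfrac : ∀ l e c, P (frac I F l e c)) (z : Away I F) :
    P z := by
  induction z using Localization.induction_on with
  | H x =>
    obtain ⟨r, s, l, rfl⟩ := x
    obtain ⟨p, rfl⟩ := Ideal.Quotient.mk_surjective r
    have := mk_sum_eq_sum_frac I F l p
    refine this ▸ Finset.sum_induction _ P hadd h0 fun e _ => hfrac l e _

/-- The ring homomorphism `S → R[ℤ^n]` that sends a monomial to its residue class, placed in the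
degree given by its exponents of `Y_1, …, Y_n`. -/
noncomputable def polyCoaction : MvPolynomial (Fin m ⊕ Fin n) K →+*
    AddMonoidAlgebra (MvPolynomial (Fin m ⊕ Fin n) K ⧸ I) (Fin n → ℤ) :=
  eval₂Hom (AddMonoidAlgebra.singleZeroRingHom.comp ((Ideal.Quotient.mk I).comp C))
    fun i => AddMonoidAlgebra.single (yExponent (Finsupp.single i 1)) (Ideal.Quotient.mk I (X i))

theorem yExponent_add (e e' : Fin m ⊕ Fin n →₀ ℕ) :
    yExponent (e + e') = yExponent e + yExponent e' := by
  funext k; simp [yExponent]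

theorem polyCoaction_monomial (e : Fin m ⊕ Fin n →₀ ℕ) (c : K) :
    polyCoaction I (monomial e c) =
      AddMonoidAlgebra.single (yExponent e) (Ideal.Quotient.mk I (monomial e c)) := by
  have h1 : polyCoaction I (monomial e 1) =
      AddMonoidAlgebra.single (yExponent e) (Ideal.Quotient.mk I (monomial e 1)) := by
    induction e using Finsupp.induction_linear with
    | zero =>
      rw [show monomial (0 : Fin m ⊕ Fin n →₀ ℕ) (1 : K) = 1 from rfl, map_one, map_one]
      rfl
    | add f g hf hg =>
      rw [← one_mul (1 : K), ← monomial_mul, map_mul, hf, hg, AddMonoidAlgebra.single_mul_single,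
        yExponent_add, map_mul]
    | single i k =>
      rw [← X_pow_eq_monomial, map_pow, polyCoaction, eval₂Hom_X', AddMonoidAlgebra.single_pow,
        map_pow]
      congr 1
      funext k'
      simp [yExponent, Finsupp.single_apply]
  have hc : polyCoaction I (C c) = AddMonoidAlgebra.single 0 (Ideal.Quotient.mk I (C c)) := by
    rw [polyCoaction, eval₂Hom_C]; rfl
  rw [← mul_one c, ← C_mul_monomial, map_mul, h1, hc, AddMonoidAlgebra.single_mul_single, zero_add,
    map_mul]

variable {I}

theorem polyCoaction_eq_zero (hI : IsMonomialIdeal I) {p : MvPolynomial (Fin m ⊕ Fin n) K}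
    (hp : p ∈ I) :
    polyCoaction I p = 0 := by
  obtain ⟨T, hT⟩ := hI
  have hle : I ≤ RingHom.ker (polyCoaction I) := by
    conv_lhs => rw [hT]
    rw [Ideal.span_le]
    rintro _ ⟨e, he, rfl⟩
    rw [SetLike.mem_coe, RingHom.mem_ker, polyCoaction_monomial,
      Ideal.Quotient.eq_zero_iff_mem.2 (by rw [hT]; exact Ideal.subset_span ⟨e, he, rfl⟩),
      AddMonoidAlgebra.single_zero]
  exact hle hp

/-- The coaction `R → R[ℤ^n]` that encodes the multigrading of `R`: it sends `r`, homogeneous of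
degree `b`, to `r T^b`. That `I` is a monomial ideal makes it well defined. -/
noncomputable def coaction₀ (hI : IsMonomialIdeal I) : (MvPolynomial (Fin m ⊕ Fin n) K ⧸ I) →+*
    AddMonoidAlgebra (MvPolynomial (Fin m ⊕ Fin n) K ⧸ I) (Fin n → ℤ) :=
  Ideal.Quotient.lift I (polyCoaction I) fun _ => polyCoaction_eq_zero hI

theorem coaction₀_mk (hI : IsMonomialIdeal I) (e : Fin m ⊕ Fin n →₀ ℕ) (c : K) :
    coaction₀ hI (Ideal.Quotient.mk I (monomial e c)) =
      AddMonoidAlgebra.single (yExponent e) (Ideal.Quotient.mk I (monomial e c)) := by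
  rw [coaction₀, Ideal.Quotient.lift_mk, polyCoaction_monomial]

theorem coaction₀_y (hI : IsMonomialIdeal I) (k : Fin n) :
    coaction₀ hI (y I k) = AddMonoidAlgebra.single (Pi.single k 1) (y I k) := by
  rw [y, X, coaction₀_mk]
  congr 1
  funext k'
  simp [yExponent, Finsupp.single_apply, Pi.single_apply, eq_comm]

theorem coaction₀_prodOn (hI : IsMonomialIdeal I) (F : Finset (Fin n)) :
    coaction₀ hI (Cech.prodOn (y I) F) =
      AddMonoidAlgebra.single (indicator F) (Cech.prodOn (y I) F) := by
  have h : indicator F = ∑ k ∈ F, Pi.single k 1 := by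
    funext k'
    simp [indicator, Finset.sum_apply, Pi.single_apply]
  rw [h, Cech.prodOn, map_prod]
  induction F using Finset.cons_induction with
  | empty => rfl
  | cons k F hk ih =>
    rw [Finset.prod_cons, Finset.prod_cons, Finset.sum_cons, ih (by
      funext k'
      simp [indicator, Finset.sum_apply, Pi.single_apply]), coaction₀_y,
      AddMonoidAlgebra.single_mul_single]

/-- The composite of the coaction of `R` with the natural map `R[ℤ^n] → R_{y_F}[ℤ^n]`. -/
noncomputable def coactionTo (hI : IsMonomialIdeal I) (F : Finset (Fin n)) :
    (MvPolynomial (Fin m ⊕ Fin n) K ⧸ I) →+* AddMonoidAlgebra (Away I F) (Fin n → ℤ) :=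
  (AddMonoidAlgebra.mapRingHom _ (algebraMap _ (Away I F))).comp (coaction₀ hI)

theorem isUnit_coactionTo_prodOn (hI : IsMonomialIdeal I) (F : Finset (Fin n)) :
    IsUnit (coactionTo hI F (Cech.prodOn (y I) F)) := by
  rw [coactionTo, RingHom.comp_apply, coaction₀_prodOn, AddMonoidAlgebra.mapRingHom_single]
  obtain ⟨u, hu⟩ := (IsLocalization.Away.algebraMap_isUnit (S := Away I F)
    (Cech.prodOn (y I) F)).exists_right_inv
  refine IsUnit.of_mul_eq_one (AddMonoidAlgebra.single (-indicator F) u) ?_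
  rw [AddMonoidAlgebra.single_mul_single, hu, add_neg_cancel]
  rfl

/-- The coaction `R_{y_F} → R_{y_F}[ℤ^n]` that encodes the multigrading of `R_{y_F}`. -/
noncomputable def coaction (hI : IsMonomialIdeal I) (F : Finset (Fin n)) :
    Away I F →+* AddMonoidAlgebra (Away I F) (Fin n → ℤ) :=
  IsLocalization.Away.lift _ (isUnit_coactionTo_prodOn hI F)

theorem coaction_algebraMap (hI : IsMonomialIdeal I) (F : Finset (Fin n))
    (r : MvPolynomial (Fin m ⊕ Fin n) K ⧸ I) :
    coaction hI F (algebraMap _ _ r) =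
      AddMonoidAlgebra.mapRingHom _ (algebraMap _ (Away I F)) (coaction₀ hI r) :=
  IsLocalization.Away.lift_eq _ (isUnit_coactionTo_prodOn hI F) r

theorem coaction_frac (hI : IsMonomialIdeal I) (F : Finset (Fin n)) (l : ℕ)
    (e : Fin m ⊕ Fin n →₀ ℕ) (c : K) :
    coaction hI F (frac I F l e c) =
      AddMonoidAlgebra.single (yExponent e - l • indicator F) (frac I F l e c) := by
  have h : algebraMap _ (Away I F) (Cech.prodOn (y I) F) ^ l * frac I F l e c =
      algebraMap _ (Away I F) (Ideal.Quotient.mk I (monomial e c)) := by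
    rw [frac, Localization.mk_eq_mk', ← map_pow]
    exact IsLocalization.mk'_spec' (Away I F) _
      (⟨Cech.prodOn (y I) F ^ l, l, rfl⟩ : Submonoid.powers (Cech.prodOn (y I) F))
  have hu : IsUnit (coaction hI F (algebraMap _ (Away I F) (Cech.prodOn (y I) F) ^ l)) :=
    ((IsLocalization.Away.algebraMap_isUnit (Cech.prodOn (y I) F)).pow l).map _
  refine hu.mul_left_cancel ?_
  rw [← map_mul, h, coaction_algebraMap, coaction₀_mk, AddMonoidAlgebra.mapRingHom_single,
    map_pow, coaction_algebraMap, coaction₀_prodOn, AddMonoidAlgebra.mapRingHom_single,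
    AddMonoidAlgebra.single_pow, AddMonoidAlgebra.single_mul_single, h, add_sub_cancel]

/-- The component of degree `b` of an element of `R_{y_F}`. -/
noncomputable def component (hI : IsMonomialIdeal I) (F : Finset (Fin n)) (b : Fin n → ℤ) :
    Away I F →+ Away I F where
  toFun z := (coaction hI F z).coeff b
  map_zero' := by simp
  map_add' := by simp

theorem component_frac (hI : IsMonomialIdeal I) (F : Finset (Fin n)) (b : Fin n → ℤ) (l : ℕ)
    (e : Fin m ⊕ Fin n →₀ ℕ) (c : K) :
    component hI F b (frac I F l e c) =
      if yExponent e - l • indicator F = b then frac I F l e c else 0 := by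
  simp [component, coaction_frac, Finsupp.single_apply]

theorem component_component (hI : IsMonomialIdeal I) (F : Finset (Fin n)) (b : Fin n → ℤ)
    (z : Away I F) : component hI F b (component hI F b z) = component hI F b z := by
  induction z using away_induction with
  | h0 => simp
  | hadd z z' hz hz' => rw [map_add, map_add, hz, hz']
  | hfrac l e c =>
    rw [component_frac]
    split_ifs with h
    · rw [component_frac, if_pos h]
    · rw [map_zero]

/-- For `k ∉ F`, the degrees of the elements of `R_{y_F}` have nonnegative `k`-th coordinates. -/
theorem component_eq_zero_of_neg (hI : IsMonomialIdeal I) {F : Finset (Fin n)} {b : Fin n → ℤ}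
    {k : Fin n} (hk : k ∉ F) (hb : b k < 0) (z : Away I F) : component hI F b z = 0 := by
  induction z using away_induction with
  | h0 => simp
  | hadd z z' hz hz' => rw [map_add, hz, hz', add_zero]
  | hfrac l e c =>
    rw [component_frac, if_neg]
    rintro rfl
    simp [indicator, hk, yExponent] at hb
    omega

theorem sum_component (hI : IsMonomialIdeal I) (F : Finset (Fin n)) (z : Away I F)
    {s : Finset (Fin n → ℤ)} (hs : (coaction hI F z).coeff.support ⊆ s) :
    ∑ b ∈ s, component hI F b z = z := by
  have h : (coaction hI F z).coeff.sum (fun _ a => a) = z := by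
    clear hs
    induction z using away_induction with
    | h0 => simp
    | hadd z z' hz hz' =>
      rw [map_add, AddMonoidAlgebra.coeff_add, Finsupp.sum_add_index' (by simp) (by simp), hz, hz']
    | hfrac l e c => rw [coaction_frac, AddMonoidAlgebra.coeff_single, Finsupp.sum_single_index rfl]
  rw [← Finset.sum_subset hs]
  · exact h
  · exact fun b _ hb => Finsupp.notMem_support_iff.1 hb

theorem component_res (hI : IsMonomialIdeal I) {F G : Finset (Fin n)} (h : F ⊆ G)
    (b : Fin n → ℤ) (z : Away I F) :
    component hI G b (Cech.res (y I) h z) = Cech.res (y I) h (component hI F b z) := by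
  obtain ⟨f, hf⟩ : ∃ f : Away I F →ₐ[MvPolynomial (Fin m ⊕ Fin n) K ⧸ I] Away I G,
      ∀ x, Cech.res (y I) h x = f x :=
    ⟨IsLocalization.liftAlgHom (M := Submonoid.powers (Cech.prodOn (y I) F))
      (f := Algebra.ofId _ (Away I G)) _, fun _ => rfl⟩
  have hf' : (f : Away I F →+* Away I G).comp (algebraMap _ _) = algebraMap _ _ :=
    f.comp_algebraMap
  have key : (coaction hI G).comp (f : Away I F →+* Away I G) =
      (AddMonoidAlgebra.mapRingHom _ (f : Away I F →+* Away I G)).comp (coaction hI F) := by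
    refine IsLocalization.ringHom_ext (Submonoid.powers (Cech.prodOn (y I) F)) (RingHom.ext ?_)
    intro r
    simp only [RingHom.comp_apply, RingHom.coe_coe, f.commutes, coaction_algebraMap]
    rw [← RingHom.comp_apply (AddMonoidAlgebra.mapRingHom _ (f : Away I F →+* Away I G)),
      ← AddMonoidAlgebra.mapRingHom_comp, hf']
  have := congrArg (fun a => a.coeff b) (RingHom.congr_fun key z)
  simpa [hf, component] using this

theorem component_y_mul (hI : IsMonomialIdeal I) (F : Finset (Fin n)) (b : Fin n → ℤ) (k : Fin n)
    (z : Away I F) :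
    component hI F (b + Pi.single k 1) (algebraMap _ (Away I F) (y I k) * z) =
      algebraMap _ (Away I F) (y I k) * component hI F b z := by
  simp only [component, AddMonoidHom.coe_mk, ZeroHom.coe_mk, map_mul,
    coaction_algebraMap, coaction₀_y, AddMonoidAlgebra.mapRingHom_single,
    AddMonoidAlgebra.coeff_single_mul_apply]
  congr 2
  abel

theorem exists_of_mem_piece {j : ℤ} {r : MvPolynomial (Fin m ⊕ Fin n) K ⧸ I} (hr : r ∈ piece I j) :
    ∃ p : MvPolynomial (Fin m ⊕ Fin n) K, Ideal.Quotient.mk I p = r ∧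
      ∀ e ∈ p.support, ∑ k, yExponent e k = j := by
  obtain ⟨p, hp, rfl⟩ := hr
  refine ⟨p, rfl, fun e he => ?_⟩
  have := hp (mem_support_iff.1 he)
  rw [← this, Finsupp.weight_apply, Finsupp.sum_fintype _ _ (by simp)]
  simp [yExponent]

theorem component_mul_of_mem (hI : IsMonomialIdeal I) (F : Finset (Fin n)) (b : Fin n → ℤ)
    {r : MvPolynomial (Fin m ⊕ Fin n) K ⧸ I} (hr : r ∈ piece I 0) (z : Away I F) :
    component hI F b (algebraMap _ (Away I F) r * z) =
      algebraMap _ (Away I F) r * component hI F b z := by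
  have h : coaction₀ hI r = AddMonoidAlgebra.single 0 r := by
    obtain ⟨p, rfl, hp⟩ := exists_of_mem_piece hr
    rw [p.as_sum, map_sum, map_sum, ← AddMonoidAlgebra.singleAddHom_apply, map_sum]
    refine Finset.sum_congr rfl fun e he => ?_
    -- the exponents are nonnegative and add up to `0`
    have h0 : yExponent e = 0 := by
      have := (Finset.sum_eq_zero_iff_of_nonneg
        (fun k _ => by simp [yExponent] : ∀ k ∈ Finset.univ, 0 ≤ yExponent e k)).1 (hp e he)
      exact funext fun k => this k (Finset.mem_univ k)
    rw [coaction₀_mk, h0, AddMonoidAlgebra.singleAddHom_apply]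
  simp only [component, AddMonoidHom.coe_mk, ZeroHom.coe_mk, map_mul,
    coaction_algebraMap, h, AddMonoidAlgebra.mapRingHom_single,
    AddMonoidAlgebra.coeff_single_mul_apply]
  rw [neg_zero, zero_add]

theorem sum_indicator (F : Finset (Fin n)) : ∑ k, indicator F k = F.card := by
  simp [indicator]

theorem frac_mem_awayPiece (F : Finset (Fin n)) (l : ℕ) (e : Fin m ⊕ Fin n →₀ ℕ) (c : K) {j : ℤ}
    (h : ∑ k, yExponent e k = j + l * F.card) :
    frac I F l e c ∈ Cech.awayPiece (piece I) (y I) (y_mem I) F j := by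
  refine ⟨l, _, ⟨monomial e c, ?_, rfl⟩, rfl⟩
  refine isWeightedHomogeneous_monomial _ _ _ ?_
  rw [← h, Finsupp.weight_apply, Finsupp.sum_fintype _ _ (by simp)]
  simp [yExponent]

theorem component_mem_awayPiece (hI : IsMonomialIdeal I) {F : Finset (Fin n)} (b : Fin n → ℤ)
    {j : ℤ} {z : Away I F} (hz : z ∈ Cech.awayPiece (piece I) (y I) (y_mem I) F j) :
    component hI F b z ∈ Cech.awayPiece (piece I) (y I) (y_mem I) F j := by
  obtain ⟨l, r, hr, rfl⟩ := hz
  obtain ⟨p, rfl, hp⟩ := exists_of_mem_piece hr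
  rw [mk_sum_eq_sum_frac, map_sum]
  refine sum_mem fun e he => ?_
  rw [component_frac]
  split_ifs
  · exact frac_mem_awayPiece F l e _ (hp e he)
  · exact zero_mem _

theorem component_eq_zero_of_mem_awayPiece (hI : IsMonomialIdeal I) {F : Finset (Fin n)}
    {b : Fin n → ℤ} {j : ℤ} (hb : ∑ k, b k ≠ j) {z : Away I F}
    (hz : z ∈ Cech.awayPiece (piece I) (y I) (y_mem I) F j) : component hI F b z = 0 := by
  obtain ⟨l, r, hr, rfl⟩ := hz
  obtain ⟨p, rfl, hp⟩ := exists_of_mem_piece hr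
  rw [mk_sum_eq_sum_frac, map_sum]
  refine Finset.sum_eq_zero fun e he => ?_
  rw [component_frac, if_neg]
  rintro rfl
  apply hb
  simp [Finset.sum_sub_distrib, ← Finset.mul_sum, sum_indicator, hp e he]

end MonomialQuotient

/-! ### Supports of the graded pieces of local cohomology -/

namespace MonomialQuotient

open MvPolynomial

variable {K : Type*} [Field K] {m n : ℕ} {I : Ideal (MvPolynomial (Fin m ⊕ Fin n) K)}

/-- The component of multidegree `b` of a Čech cochain. -/
noncomputable def cochainComponent (hI : IsMonomialIdeal I) (t : ℕ) (b : Fin n → ℤ) :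
    Cech.Cochain (y I) t →+ Cech.Cochain (y I) t where
  toFun z F := component hI F.1 b (z F)
  map_zero' := funext fun _ => map_zero _
  map_add' _ _ := funext fun _ => map_add _ _ _

theorem cochainComponent_apply (hI : IsMonomialIdeal I) (t : ℕ) (b : Fin n → ℤ)
    (z : Cech.Cochain (y I) t) (F) :
    cochainComponent hI t b z F = component hI F.1 b (z F) := rfl

theorem d_cochainComponent (hI : IsMonomialIdeal I) (t : ℕ) (b : Fin n → ℤ)
    (z : Cech.Cochain (y I) t) :
    Cech.d (y I) t (cochainComponent hI t b z) =
      cochainComponent hI (t + 1) b (Cech.d (y I) t z) := by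
  funext G
  simp only [cochainComponent_apply, Cech.d_apply, map_sum, map_zsmul, component_res]

theorem cochainComponent_mem_supportedOn (hI : IsMonomialIdeal I) (t : ℕ) {b : Fin n → ℤ}
    {k : Fin n} (hb : b k < 0) (z : Cech.Cochain (y I) t) :
    cochainComponent hI t b z ∈ Cech.supportedOn (y I) k t :=
  fun _ hF => component_eq_zero_of_neg hI hF hb _

theorem cochainComponent_idem (hI : IsMonomialIdeal I) (t : ℕ) (b : Fin n → ℤ)
    (z : Cech.Cochain (y I) t) :
    cochainComponent hI t b (cochainComponent hI t b z) = cochainComponent hI t b z :=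
  funext fun _ => component_component hI _ b _

theorem cochainComponent_smul_y (hI : IsMonomialIdeal I) (t : ℕ) (b : Fin n → ℤ) (k : Fin n)
    (z : Cech.Cochain (y I) t) :
    cochainComponent hI t (b + Pi.single k 1) (y I k • z) = y I k • cochainComponent hI t b z :=
  funext fun F => by
    rw [cochainComponent_apply, Pi.smul_apply, Pi.smul_apply, Cech.smul_away_eq, Cech.smul_away_eq]
    exact component_y_mul hI F.1 b k (z F)

theorem cochainComponent_smul_of_mem (hI : IsMonomialIdeal I) (t : ℕ) (b : Fin n → ℤ)
    {r : MvPolynomial (Fin m ⊕ Fin n) K ⧸ I} (hr : r ∈ piece I 0) (z : Cech.Cochain (y I) t) :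
    cochainComponent hI t b (r • z) = r • cochainComponent hI t b z :=
  funext fun F => by
    rw [cochainComponent_apply, Pi.smul_apply, Pi.smul_apply, Cech.smul_away_eq, Cech.smul_away_eq]
    exact component_mul_of_mem hI F.1 b hr (z F)

theorem exists_sum_cochainComponent (hI : IsMonomialIdeal I) (t : ℕ) (z : Cech.Cochain (y I) t) :
    ∃ s : Finset (Fin n → ℤ), ∑ b ∈ s, cochainComponent hI t b z = z := by
  classical
  have h : ∀ F : {F : Finset (Fin n) // F.card = t}, ∃ s : Finset (Fin n → ℤ), ∀ s', s ⊆ s' →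
      ∑ b ∈ s', component hI F.1 b (z F) = z F :=
    fun F => ⟨_, fun s' hs' => sum_component hI F.1 (z F) hs'⟩
  choose s hs using h
  refine ⟨Finset.univ.biUnion s, funext fun F => ?_⟩
  rw [Finset.sum_apply]
  exact hs F _ (Finset.subset_biUnion_of_mem s (Finset.mem_univ F))

/-- Dividing by `y_k` preserves coboundaries in multidegrees whose `k`-th coordinate stays
negative: the cochain that bounds can be taken of the same multidegree, and then it can be divided
by `y_k` too. -/
theorem mem_coboundaries_of_smul_y (hI : IsMonomialIdeal I) (i : ℕ) {b : Fin n → ℤ} {k : Fin n}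
    (hb : b k < -1) {v : Cech.Cochain (y I) i} (hv : cochainComponent hI i b v = v)
    (h : y I k • v ∈ Cech.coboundaries (y I) i) : v ∈ Cech.coboundaries (y I) i := by
  have hvk : v ∈ Cech.supportedOn (y I) k i :=
    hv ▸ cochainComponent_mem_supportedOn hI i (by omega) v
  cases i with
  | zero =>
    rw [Cech.coboundaries, Submodule.mem_bot] at h ⊢
    exact Cech.smul_injOn_supportedOn _ hvk (zero_mem _) (by rw [h, smul_zero])
  | succ t =>
    obtain ⟨w, hw⟩ := h
    refine Cech.mem_range_d_of_smul _ hvk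
      (cochainComponent_mem_supportedOn hI t (b := b + Pi.single k 1) (by simp; omega) w) ?_
    rw [d_cochainComponent, hw, cochainComponent_smul_y, hv]

theorem mem_support_localCohomologyPiece_iff {i : ℕ} {j : ℤ} {p : PrimeSpectrum (R₀ I)} :
    p ∈ Module.support (R₀ I) (localCohomologyPiece I i j) ↔
      ∃ z : Cech.Cochain (y I) i, Cech.d (y I) i z = 0 ∧
        (∀ F, z F ∈ Cech.awayPiece (piece I) (y I) (y_mem I) F.1 j) ∧
        ∀ r : R₀ I, r ∉ p.asIdeal → r.1 • z ∉ Cech.coboundaries (y I) i := by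
  have key : ∀ (z : Cech.cocycles (y I) i) (r : R₀ I),
      r • (Submodule.Quotient.mk z : LocalCohomology I i) = 0 ↔
        r.1 • z.1 ∈ Cech.coboundaries (y I) i := by
    intro z r
    exact Submodule.Quotient.mk_eq_zero (x := r.1 • z) _
  rw [Module.mem_support_iff']
  constructor
  · rintro ⟨⟨_, z, hz, rfl⟩, h⟩
    exact ⟨z.1, z.2, hz, fun r hr hc => h r hr (Subtype.ext ((key z r).2 hc))⟩
  · rintro ⟨z, hz, hzj, h⟩
    exact ⟨⟨Submodule.Quotient.mk ⟨z, hz⟩, ⟨z, hz⟩, hzj, rfl⟩,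
      fun r hr hc => h r hr ((key ⟨z, hz⟩ r).1 (congrArg Subtype.val hc))⟩

/-- A point of the support is detected by a multihomogeneous cocycle, since the multigraded
components of a cocycle are cocycles. -/
theorem exists_component_of_mem_support (hI : IsMonomialIdeal I) {i : ℕ} {j : ℤ}
    {p : PrimeSpectrum (R₀ I)} (hp : p ∈ Module.support (R₀ I) (localCohomologyPiece I i j)) :
    ∃ (b : Fin n → ℤ) (z : Cech.Cochain (y I) i), ∑ k, b k = j ∧ cochainComponent hI i b z = z ∧
      Cech.d (y I) i z = 0 ∧ (∀ F, z F ∈ Cech.awayPiece (piece I) (y I) (y_mem I) F.1 j) ∧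
      ∀ r : R₀ I, r ∉ p.asIdeal → r.1 • z ∉ Cech.coboundaries (y I) i := by
  obtain ⟨z, hz, hzj, h⟩ := mem_support_localCohomologyPiece_iff.1 hp
  obtain ⟨s, hs⟩ := exists_sum_cochainComponent hI i z
  obtain ⟨b, hb⟩ : ∃ b, ∀ r : R₀ I, r ∉ p.asIdeal →
      r.1 • cochainComponent hI i b z ∉ Cech.coboundaries (y I) i := by
    -- Otherwise each component is annihilated modulo coboundaries by some `r b ∉ p`, and the
    -- product of these elements annihilates `z` modulo coboundaries.
    by_contra! hc
    choose r hr hrc using hc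
    refine h (∏ b ∈ s, r b) (fun hmem => ?_) ?_
    · obtain ⟨b, -, hb⟩ := (p.isPrime.prod_mem_iff).1 hmem
      exact hr b hb
    · rw [← hs, SubmonoidClass.coe_finsetProd]
      exact Submodule.prod_smul_sum_mem _ s (fun b _ => hrc b)
  -- A component of total degree other than `j` would be zero, so `b` has total degree `j`.
  refine ⟨b, cochainComponent hI i b z, ?_, cochainComponent_idem hI i b z, ?_,
    fun F => component_mem_awayPiece hI b (hzj F), hb⟩
  · by_contra hbj
    refine hb 1 (fun h1 => p.isPrime.ne_top ((Ideal.eq_top_iff_one _).2 h1)) ?_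
    have h0 : cochainComponent hI i b z = 0 :=
      funext fun F => component_eq_zero_of_mem_awayPiece hI hbj (hzj F)
    rw [h0, smul_zero]
    exact zero_mem _
  · rw [d_cochainComponent, hz, map_zero]

/-- In degrees below `-n`, multiplication by the `y_k` shows that the support grows with the
degree: a multidegree `b` of total degree `j < -n` has a coordinate `b_k ≤ -2`, and then
multiplication by `y_k` is injective on the component of multidegree `b`. -/
theorem support_localCohomologyPiece_subset_succ (hI : IsMonomialIdeal I) (i : ℕ) {j : ℤ}
    (hj : j < -n) :
    Module.support (R₀ I) (localCohomologyPiece I i j) ⊆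
      Module.support (R₀ I) (localCohomologyPiece I i (j + 1)) := by
  intro p hp
  obtain ⟨b, z, rfl, hbz, hz, hzj, h⟩ := exists_component_of_mem_support hI hp
  obtain ⟨k, hk⟩ : ∃ k, b k < -1 := by
    by_contra! hc
    have := Finset.sum_le_sum fun k (_ : k ∈ Finset.univ) => hc k
    simp at this
    omega
  refine mem_support_localCohomologyPiece_iff.2 ⟨y I k • z, ?_,
    fun F => Cech.smul_mem_awayPiece _ _ _ k (hzj F), fun r hr hc => h r hr ?_⟩
  · rw [Cech.d_smul, hz, smul_zero]
  · refine mem_coboundaries_of_smul_y hI i hk ?_ (smul_comm r.1 (y I k) z ▸ hc)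
    rw [cochainComponent_smul_of_mem hI i b r.2, hbz]

/-- In negative degrees, division by the `y_k` shows that the support grows as the degree
decreases: a multidegree `b` of negative total degree has a coordinate `b_k ≤ -1`, and then
multiplication by `y_k` maps onto the component of multidegree `b`. -/
theorem support_localCohomologyPiece_succ_subset (hI : IsMonomialIdeal I) (i : ℕ) {j : ℤ}
    (hj : j + 1 < 0) :
    Module.support (R₀ I) (localCohomologyPiece I i (j + 1)) ⊆
      Module.support (R₀ I) (localCohomologyPiece I i j) := by
  intro p hp
  obtain ⟨b, z, hbj, hbz, hz, hzj, h⟩ := exists_component_of_mem_support hI hp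
  obtain ⟨k, hk⟩ : ∃ k, b k < 0 := by
    by_contra! hc
    have := Finset.sum_nonneg fun k (_ : k ∈ Finset.univ) => hc k
    omega
  obtain ⟨u, hu, rfl⟩ := Cech.exists_smul_eq_of_mem_supportedOn _
    (hbz ▸ cochainComponent_mem_supportedOn hI i hk z : z ∈ Cech.supportedOn (y I) k i)
  refine mem_support_localCohomologyPiece_iff.2 ⟨u, Cech.d_eq_zero_of_smul _ hu hz, fun F => ?_,
    fun r hr hc => h r hr ?_⟩
  · by_cases hF : k ∈ F.1
    · exact Cech.mem_awayPiece_of_smul_mem _ _ _ hF (hzj F)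
    · rw [hu F hF]
      exact zero_mem _
  · rw [smul_comm]
    exact Submodule.smul_mem _ _ hc

end MonomialQuotient

theorem mainTheorem4 {K : Type*} [Field K] (m n : ℕ)
    (I : Ideal (MvPolynomial (Fin m ⊕ Fin n) K)) (hI : IsMonomialIdeal I) (i : ℕ) :
    ∃ (j₀ : ℤ) (D : WithBot ℕ∞), ∀ j : ℤ, j ≤ j₀ →
      Module.supportDim (MonomialQuotient.R₀ I)
        (MonomialQuotient.localCohomologyPiece I i j) = D := by
  refine ⟨-n - 1, Module.supportDim (MonomialQuotient.R₀ I)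
    (MonomialQuotient.localCohomologyPiece I i (-n - 1)), fun j hj => ?_⟩
  have h : Module.support (MonomialQuotient.R₀ I) (MonomialQuotient.localCohomologyPiece I i j) =
      Module.support (MonomialQuotient.R₀ I)
        (MonomialQuotient.localCohomologyPiece I i (-n - 1)) := by
    induction j, hj using Int.leInductionDown with
    | base => rfl
    | pred j hj ih =>
      rw [← ih]
      have h1 := MonomialQuotient.support_localCohomologyPiece_subset_succ hI i (j := j - 1)
        (by omega)
      have h2 := MonomialQuotient.support_localCohomologyPiece_succ_subset hI i (j := j - 1)
        (by omega)
      rw [sub_add_cancel] at h1 h2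
      exact h1.antisymm h2
  rw [Module.supportDim, Module.supportDim, h]
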